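/- There is an absolute constant $c>0$ such that the following holds. Let $N_1,n,r\ge 1$ be integers with $n\mid r$, let $n_1,\dots,n_n$ be nonnegative integers, $N_2=\sum_{i=1}^n n_i$, and let $\mathbf L=[\mathbf U_1\mathbf Q_1\ \cdots\ \mathbf U_n\mathbf Q_n]\in\mathbb R^{N_1\times N_2}$ be a random matrix, where $\mathbf U_i\in\mathbb R^{N_1\times r/n}$ and $\mathbf Q_i\in\mathbb R^{r/n\times n_i}$ are random matrices such that the column spaces of $\mathbf U_1,\dots,\mathbf U_n$ are independent, uniformly (i.e. rotation-invariantly) distributed random $r/n$-dimensional subspaces of $\mathbb R^{N_1}$, and for each $i$ the row space of $\mathbf Q_i$ is a uniformly distributed random $r/n$-dimensional subspace of $\mathbb R^{n_i}$. Suppose that $\mathbf L$ has rank $r$ almost surely, and that $m_2$ rows of $\mathbf L$ are sampled uniformly at random with replacement, independently of $\mathbf L$. If $\delta>0$ and $$m_2\ \ge\ 10\,c\,r\,\varphi\,\log\frac{2r}{\delta},\qquad \varphi=\frac{\max(r,\log N_1)}{r},$$ then the sampled rows span the row space of $\mathbf L$ with probability at least $1-\delta-2N_1^{-3}$. (The constant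 $c$ does not depend on $N_1$, $n$, $r$, $n_1,\dots,n_n$, $m_2$, $\delta$ or the joint law of the matrices.) -/

import Mathlib

open MeasureTheory ProbabilityTheory

noncomputable section

namespace RowSampling

/-- The entrywise (Borel) σ-algebra on matrices. -/
instance instMeasurableSpaceMatrix {ι κ : Type*} : MeasurableSpace (Matrix ι κ ℝ) :=
  inferInstanceAs (MeasurableSpace (ι → κ → ℝ))

/-- The column space of a real matrix, a subspace of the Euclidean space. -/
def colSpace {ι κ : Type*} (A : Matrix ι κ ℝ) : Submodule ℝ (EuclideanSpace ℝ ι) :=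
  Submodule.span ℝ (Set.range fun j => WithLp.toLp 2 (A.col j))

/-- The row space of a real matrix, a subspace of the Euclidean space. -/
def rowSpace {ι κ : Type*} (A : Matrix ι κ ℝ) : Submodule ℝ (EuclideanSpace ℝ κ) :=
  Submodule.span ℝ (Set.range fun i => WithLp.toLp 2 (A.row i))

/-- The Borel σ-algebra on the set of all linear subspaces of `ℝ^d` (the disjoint union of the
Grassmannians), where a subspace is identified with its orthogonal projection. -/
instance instMeasurableSpaceSubspace {d : ℕ} :
    MeasurableSpace (Submodule ℝ (EuclideanSpace ℝ (Fin d))) :=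
  MeasurableSpace.comap
    (fun W => (W.starProjection : EuclideanSpace ℝ (Fin d) →L[ℝ] EuclideanSpace ℝ (Fin d)))
    inferInstance

/-- `W` is a random `k`-dimensional subspace of `ℝ^d`: almost surely of dimension `k`, with a
law that is invariant under every orthogonal transformation. The orthogonal group is compact and
acts transitively on the Grassmannian, so that this is the uniform (Haar) distribution on it. -/
structure IsRandomSubspace {Ω : Type*} [MeasurableSpace Ω] (P : Measure Ω) {d : ℕ} (k : ℕ)
    (W : Ω → Submodule ℝ (EuclideanSpace ℝ (Fin d))) : Prop where
  aemeasurable : AEMeasurable W P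
  finrank_eq : ∀ᵐ ω ∂P, Module.finrank ℝ (W ω) = k
  invariant : ∀ O : EuclideanSpace ℝ (Fin d) ≃ₗᵢ[ℝ] EuclideanSpace ℝ (Fin d),
    IdentDistrib (fun ω => (W ω).map O.toLinearEquiv.toLinearMap) W P P

/-- The block matrix `[U₁ Q₁ ⋯ Uₙ Qₙ]`. Its columns are indexed by the pairs
`⟨i, j⟩` (column `j` of block `i`), so that there are `N₂ = ∑ i, nᵢ` of them. -/
def blockMatrix {N₁ n k : ℕ} {d : Fin n → ℕ} (U : Fin n → Matrix (Fin N₁) (Fin k) ℝ)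
    (Q : (i : Fin n) → Matrix (Fin k) (Fin (d i)) ℝ) :
    Matrix (Fin N₁) ((i : Fin n) × Fin (d i)) ℝ :=
  Matrix.of fun a b => (U b.1 * Q b.1) a b.2

/-- The random matrix `L` follows the random subspace clustering model with parameters `r`, `n`
and block widths `d i`: `L = [U₁ Q₁ ⋯ Uₙ Qₙ]`, where the column spaces of the `Uᵢ` are
independent random `r / n`-dimensional subspaces of `ℝ^N₁` and the row space of each `Qᵢ` is a
random `r / n`-dimensional subspace of `ℝ^(d i)`. -/
def FollowsSubspaceModel {Ω : Type*} [MeasurableSpace Ω] (P : Measure Ω) (N₁ n r : ℕ)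
    (d : Fin n → ℕ) (L : Ω → Matrix (Fin N₁) ((i : Fin n) × Fin (d i)) ℝ) : Prop :=
  0 < n ∧ n ∣ r ∧
  ∃ (U : Fin n → Ω → Matrix (Fin N₁) (Fin (r / n)) ℝ)
    (Q : (i : Fin n) → Ω → Matrix (Fin (r / n)) (Fin (d i)) ℝ),
    (∀ i, Measurable (U i)) ∧ (∀ i, Measurable (Q i)) ∧
    (∀ ω, L ω = blockMatrix (fun i => U i ω) (fun i => Q i ω)) ∧
    (∀ i, IsRandomSubspace P (r / n) fun ω => colSpace (U i ω)) ∧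
    iIndepFun (fun i ω => colSpace (U i ω)) P ∧
    (∀ i, IsRandomSubspace P (r / n) fun ω => rowSpace (Q i ω))

/-- `S 0, …, S (m - 1)` are drawn uniformly at random with replacement from `Fin N`:
they are independent, and each is uniformly distributed. -/
structure IsUniformSample {Ω : Type*} [MeasurableSpace Ω] (P : Measure Ω) {m N : ℕ}
    (S : Fin m → Ω → Fin N) : Prop where
  measurable : ∀ j, Measurable (S j)
  uniform : ∀ j i, P.real {ω | S j ω = i} = 1 / (N : ℝ)
  indep : iIndepFun S P

end RowSampling

end

/-!
Any fixed set of at least `r` rows of `L` almost surely spans its row space, because the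
column space `W` of `L`, a uniformly distributed `r`-dimensional subspace, meets `Fᗮ` trivially for
a fixed coordinate subspace `F` of dimension at least `r`. By rotation invariance only the dimension
of `F` matters, and adding almost any vector `x` to `F` cuts the dimension of `W ⊓ Fᗮ` by one
(Fubini), so the almost sure dimension is `0` once `dim F ≥ r`. It remains to sample `r` distinct
rows. This happens as soon as every residue class modulo `r` is hit; each has density at least
`1 / (2 r)`, so by the union bound some class is missed with probability at most `r e^(-m / (2 r))`.
-/

namespace RowSampling

open Module

section LinearAlgebra

variable {ι κ σ : Type*}

theorem finrank_colSpace [Fintype κ] (A : Matrix ι κ ℝ) : finrank ℝ (colSpace A) = A.rank := by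
  have h : colSpace A = (Submodule.span ℝ (Set.range A.col)).map
      (WithLp.linearEquiv 2 ℝ (ι → ℝ)).symm.toLinearMap := by
    rw [Submodule.map_span, ← Set.range_comp]
    rfl
  rw [h, LinearEquiv.finrank_map_eq, Matrix.rank_eq_finrank_span_cols]

theorem finrank_rowSpace [Finite ι] [Fintype κ] (A : Matrix ι κ ℝ) :
    finrank ℝ (rowSpace A) = A.rank := by
  have h : rowSpace A = (Submodule.span ℝ (Set.range A.row)).map
      (WithLp.linearEquiv 2 ℝ (κ → ℝ)).symm.toLinearMap := by
    rw [Submodule.map_span, ← Set.range_comp]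
    rfl
  rw [h, LinearEquiv.finrank_map_eq, Matrix.rank_eq_finrank_span_row]

theorem rowSpace_submatrix_le (A : Matrix ι κ ℝ) (s : σ → ι) :
    rowSpace (A.submatrix s id) ≤ rowSpace A := by
  refine Submodule.span_mono ?_
  rintro _ ⟨i, rfl⟩
  exact ⟨s i, rfl⟩

/-- The coordinate subspace of the vectors supported on `T`. Its orthogonal complement, the
kernel of the restriction of coordinates to `T`, controls which rows determine a row space. -/
def coordSpan [Fintype ι] [DecidableEq ι] (T : Set ι) : Submodule ℝ (EuclideanSpace ℝ ι) :=
  Submodule.span ℝ (Set.range fun i : T => EuclideanSpace.single (i : ι) (1 : ℝ))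

theorem finrank_coordSpan [Fintype ι] [DecidableEq ι] (T : Set ι) :
    finrank ℝ (coordSpan T) = T.ncard := by
  classical
  have h : LinearIndependent ℝ fun i : T => EuclideanSpace.single (i : ι) (1 : ℝ) := by
    simpa only [EuclideanSpace.basisFun_apply, Function.comp_def] using
      (EuclideanSpace.basisFun ι ℝ).orthonormal.linearIndependent.comp _ Subtype.val_injective
  rw [coordSpan, finrank_span_eq_card h, Set.ncard_eq_toFinset_card', Set.toFinset_card]

theorem mem_coordSpan_orthogonal_iff [Fintype ι] [DecidableEq ι] {T : Set ι}
    {x : EuclideanSpace ℝ ι} : x ∈ (coordSpan T)ᗮ ↔ ∀ i ∈ T, x i = 0 := by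
  simp [coordSpan, Submodule.span_range_eq_iSup, ← Submodule.iInf_orthogonal,
    Submodule.mem_orthogonal_singleton_iff_inner_right, EuclideanSpace.inner_single_left]

theorem rowSpace_submatrix_eq_of_disjoint [Fintype ι] [DecidableEq ι] [Finite κ] [Finite σ]
    {A : Matrix ι κ ℝ} {s : σ → ι} (h : Disjoint (colSpace A) (coordSpan (Set.range s))ᗮ) :
    rowSpace (A.submatrix s id) = rowSpace A := by
  cases nonempty_fintype κ
  let π : EuclideanSpace ℝ ι →ₗ[ℝ] EuclideanSpace ℝ σ :=
    (WithLp.linearEquiv 2 ℝ (σ → ℝ)).symm.toLinearMap ∘ₗ LinearMap.funLeft ℝ ℝ s ∘ₗ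
      (WithLp.linearEquiv 2 ℝ (ι → ℝ)).toLinearMap
  have hπ : (colSpace A).map π = colSpace (A.submatrix s id) := by
    unfold colSpace
    rw [Submodule.map_span, ← Set.range_comp]
    rfl
  have hker : π.ker = (coordSpan (Set.range s))ᗮ := by
    ext x
    rw [mem_coordSpan_orthogonal_iff, Set.forall_mem_range, LinearMap.mem_ker, PiLp.ext_iff]
    rfl
  have hrank : (A.submatrix s id).rank = A.rank := by
    rw [← finrank_colSpace, ← finrank_colSpace, ← hπ, ← LinearMap.range_domRestrict]
    refine LinearMap.finrank_range_of_inj (LinearMap.injective_domRestrict_iff.2 ?_)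
    rwa [hker]
  refine Submodule.eq_of_le_of_finrank_eq (rowSpace_submatrix_le A s) ?_
  rw [finrank_rowSpace, finrank_rowSpace, hrank]

theorem colSpace_mul_le [Fintype κ] (A : Matrix ι κ ℝ) (B : Matrix κ σ ℝ) :
    colSpace (A * B) ≤ colSpace A := by
  refine Submodule.span_le.2 ?_
  rintro _ ⟨j, rfl⟩
  have h : WithLp.toLp 2 ((A * B).col j) = ∑ l, B l j • WithLp.toLp 2 (A.col l) := by
    ext a
    simp [Matrix.mul_apply, mul_comm]
  change WithLp.toLp 2 ((A * B).col j) ∈ colSpace A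
  rw [h]
  exact Submodule.sum_mem _ fun l _ => Submodule.smul_mem _ _ (Submodule.subset_span ⟨l, rfl⟩)

variable {N n k : ℕ} {d : Fin n → ℕ}

theorem colSpace_blockMatrix (U : Fin n → Matrix (Fin N) (Fin k) ℝ)
    (Q : (i : Fin n) → Matrix (Fin k) (Fin (d i)) ℝ) :
    colSpace (blockMatrix U Q) = ⨆ i, colSpace (U i * Q i) := by
  simp only [colSpace, ← Submodule.span_iUnion]
  rw [Set.range_sigma_eq_iUnion_range]
  rfl

theorem finrank_iSup_colSpace_le [Fintype κ] [Fintype σ] (U : σ → Matrix ι κ ℝ) :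
    finrank ℝ ↥(⨆ i, colSpace (U i)) ≤ Fintype.card σ * Fintype.card κ := by
  have h : ⨆ i, colSpace (U i) = colSpace (Matrix.of fun a (p : σ × κ) => U p.1 a p.2) := by
    simp only [colSpace, ← Submodule.span_iUnion]
    rw [← (Equiv.sigmaEquivProd σ κ).surjective.range_comp, Set.range_sigma_eq_iUnion_range]
    rfl
  rw [h, finrank_colSpace, ← Fintype.card_prod]
  exact Matrix.rank_le_card_width _

theorem colSpace_blockMatrix_eq_iSup (U : Fin n → Matrix (Fin N) (Fin k) ℝ)
    (Q : (i : Fin n) → Matrix (Fin k) (Fin (d i)) ℝ) (h : (blockMatrix U Q).rank = n * k) :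
    colSpace (blockMatrix U Q) = ⨆ i, colSpace (U i) := by
  refine Submodule.eq_of_le_of_finrank_le ?_ ?_
  · rw [colSpace_blockMatrix]
    exact iSup_mono fun i => colSpace_mul_le (U i) (Q i)
  · rw [finrank_colSpace, h]
    simpa using finrank_iSup_colSpace_le U

end LinearAlgebra

section Projections

variable {ι E : Type*} [Fintype ι] [NormedAddCommGroup E] [InnerProductSpace ℝ E]
  [FiniteDimensional ℝ E]

theorem finrank_eq_sum_inner_starProjection (W : Submodule ℝ E) (b : OrthonormalBasis ι ℝ E) :
    (finrank ℝ W : ℝ) = ∑ i, inner ℝ (b i) (W.starProjection (b i)) := by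
  have h : LinearMap.IsProj W W.starProjection.toLinearMap :=
    ⟨W.starProjection_apply_mem, fun _ => W.starProjection_eq_self_iff.2⟩
  exact h.trace.symm.trans (LinearMap.trace_eq_sum_inner _ b)

/-- The average of the identity and of the orthogonal projections onto the subspaces `V i`: a
contraction whose fixed vectors are those of `⨅ i, V i`. The identity makes up for empty `ι`. -/
noncomputable def averageProjection (V : ι → Submodule ℝ E) : E →L[ℝ] E :=
  (Fintype.card ι + 1 : ℝ)⁻¹ • (1 + ∑ i, (V i).starProjection)

theorem norm_averageProjection_le (V : ι → Submodule ℝ E) : ‖averageProjection V‖ ≤ 1 := by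
  have h : ‖1 + ∑ i, (V i).starProjection‖ ≤ Fintype.card ι + 1 := by
    calc ‖1 + ∑ i, (V i).starProjection‖ ≤ ‖(1 : E →L[ℝ] E)‖ + ∑ i, ‖(V i).starProjection‖ :=
          (norm_add_le _ _).trans (by gcongr; exact norm_sum_le _ _)
      _ ≤ 1 + ∑ _i : ι, 1 := by
          gcongr with i
          · exact ContinuousLinearMap.norm_id_le
          · exact (V i).starProjection_norm_le
      _ = Fintype.card ι + 1 := by simp [add_comm]
  rw [averageProjection, norm_smul, norm_inv, Real.norm_of_nonneg (by positivity)]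
  exact inv_mul_le_one_of_le₀ h (by positivity)

theorem sum_starProjection_eq_zero_iff {V : ι → Submodule ℝ E} {x : E} :
    ∑ i, (V i).starProjection x = 0 ↔ ∀ i, x ∈ (V i)ᗮ := by
  simp_rw [← Submodule.starProjection_apply_eq_zero_iff]
  refine ⟨fun h i => ?_, fun h => Finset.sum_eq_zero fun i _ => h i⟩
  have hnorm : ∑ i, ‖(V i).starProjection x‖ ^ 2 = 0 := by
    rw [← inner_zero_left x, ← h, sum_inner]
    exact Finset.sum_congr rfl fun i _ => ((V i).re_inner_starProjection_eq_normSq x).symm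
  have hi := (Finset.sum_eq_zero_iff_of_nonneg fun i _ => by positivity).1 hnorm i
  simpa using hi

theorem eqLocus_averageProjection (V : ι → Submodule ℝ E) :
    (averageProjection V).eqLocus (1 : E →L[ℝ] E) = ⨅ i, V i := by
  ext x
  have hc : (Fintype.card ι + 1 : ℝ) ≠ 0 := by positivity
  have hfix : averageProjection V x = x ↔ ∑ i, (V i)ᗮ.starProjection x = 0 := by
    rw [averageProjection, smul_apply, inv_smul_eq_iff₀ hc, add_smul, one_smul, add_comm]
    simp only [add_apply, sum_apply, one_apply_eq_self, Nat.cast_smul_eq_nsmul, add_left_inj,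
      Submodule.starProjection_orthogonal_val, Finset.sum_sub_distrib, Finset.sum_const,
      Finset.card_univ, sub_eq_zero]
    exact eq_comm
  rw [Submodule.mem_iInf]
  refine hfix.trans (sum_starProjection_eq_zero_iff.trans ?_)
  simp only [Submodule.orthogonal_orthogonal]

end Projections

section Measurability

variable {N : ℕ}

theorem measurable_starProjection : Measurable
    fun W : Submodule ℝ (EuclideanSpace ℝ (Fin N)) => W.starProjection :=
  Measurable.of_comap_le le_rfl

theorem measurable_continuousLinearMap_iff {α E F : Type*} [MeasurableSpace α]
    [NormedAddCommGroup E] [InnerProductSpace ℝ E] [FiniteDimensional ℝ E]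
    [NormedAddCommGroup F] [NormedSpace ℝ F] [MeasurableSpace F] [BorelSpace F]
    [FiniteDimensional ℝ F] {f : α → E →L[ℝ] F} :
    Measurable f ↔ ∀ x, Measurable fun a => f a x := by
  refine ⟨fun h x => h.apply_continuousLinearMap x, fun h => ?_⟩
  let b := stdOrthonormalBasis ℝ E
  have hf : f = fun a => ∑ i, InnerProductSpace.rankOne ℝ (f a (b i)) (b i) := by
    ext a x
    conv_lhs => rw [← b.sum_repr x]
    simp [b.repr_apply_apply]
  rw [hf]
  refine Finset.measurable_sum _ fun i _ => Measurable.comp (g := fun y =>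
    InnerProductSpace.rankOne ℝ y (b i)) (Continuous.measurable ?_) (h (b i))
  fun_prop

theorem measurable_submodule_iff {α : Type*} [MeasurableSpace α]
    {W : α → Submodule ℝ (EuclideanSpace ℝ (Fin N))} :
    Measurable W ↔ ∀ x, Measurable fun a => (W a).starProjection x :=
  measurable_comap_iff.trans measurable_continuousLinearMap_iff

theorem measurable_starProjection_apply (x : EuclideanSpace ℝ (Fin N)) : Measurable
    fun W : Submodule ℝ (EuclideanSpace ℝ (Fin N)) => W.starProjection x :=
  measurable_submodule_iff.1 measurable_id x

theorem measurable_submodule_map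
    (O : EuclideanSpace ℝ (Fin N) ≃ₗᵢ[ℝ] EuclideanSpace ℝ (Fin N)) :
    Measurable fun W : Submodule ℝ (EuclideanSpace ℝ (Fin N)) =>
      W.map O.toLinearEquiv.toLinearMap := by
  refine measurable_submodule_iff.2 fun x => ?_
  simp_rw [Submodule.starProjection_map_apply]
  exact O.continuous.measurable.comp (measurable_starProjection_apply _)

theorem measurable_orthogonal :
    Measurable fun W : Submodule ℝ (EuclideanSpace ℝ (Fin N)) => Wᗮ := by
  refine measurable_submodule_iff.2 fun x => ?_
  simp_rw [Submodule.starProjection_orthogonal_val]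
  exact measurable_const.sub (measurable_starProjection_apply x)

theorem measurable_span_singleton :
    Measurable fun x : EuclideanSpace ℝ (Fin N) => Submodule.span ℝ {x} := by
  refine measurable_submodule_iff.2 fun y => ?_
  simp_rw [Submodule.starProjection_singleton]
  have hcoef : Measurable fun x : EuclideanSpace ℝ (Fin N) => inner ℝ x y / ‖x‖ ^ 2 :=
    (measurable_id.inner measurable_const).div (measurable_norm.pow_const 2)
  exact hcoef.smul measurable_id

theorem measurable_averageProjection {ι : Type*} [Fintype ι] : Measurable
    fun V : ι → Submodule ℝ (EuclideanSpace ℝ (Fin N)) => averageProjection V := by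
  unfold averageProjection
  refine Measurable.const_smul (Measurable.const_add ?_ 1) (Fintype.card ι + 1 : ℝ)⁻¹
  exact Finset.measurable_sum _ fun i _ => measurable_starProjection.comp (measurable_pi_apply i)

-- By the mean ergodic theorem, the projection onto an intersection is the limit of the ergodic
-- averages of the averaged projections.
theorem measurable_iInf {ι : Type*} [Finite ι] : Measurable
    fun V : ι → Submodule ℝ (EuclideanSpace ℝ (Fin N)) => ⨅ i, V i := by
  cases nonempty_fintype ι
  refine measurable_submodule_iff.2 fun x => ?_
  have hlim : ∀ V : ι → Submodule ℝ (EuclideanSpace ℝ (Fin N)), Filter.Tendsto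
      (birkhoffAverage ℝ (averageProjection V) id · x) Filter.atTop
      (nhds ((⨅ i, V i).starProjection x)) := fun V => by
    rw [← eqLocus_averageProjection V]
    exact (averageProjection V).tendsto_birkhoffAverage_orthogonalProjection
      (norm_averageProjection_le V) x
  refine measurable_of_tendsto_metrizable (fun n => ?_) (tendsto_pi_nhds.2 hlim)
  refine Measurable.const_smul (Finset.measurable_sum _ fun j _ => ?_) (n : ℝ)⁻¹
  simp_rw [id, ← FunLike.coe_pow_eq_iterate]
  exact measurable_continuousLinearMap_iff.1
    ((continuous_pow j).measurable.comp measurable_averageProjection) x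

theorem measurable_iSup {ι : Type*} [Finite ι] : Measurable
    fun V : ι → Submodule ℝ (EuclideanSpace ℝ (Fin N)) => ⨆ i, V i := by
  have h (V : ι → Submodule ℝ (EuclideanSpace ℝ (Fin N))) : ⨆ i, V i = (⨅ i, (V i)ᗮ)ᗮ := by
    rw [Submodule.iInf_orthogonal, Submodule.orthogonal_orthogonal]
  simp_rw [h]
  exact measurable_orthogonal.comp (measurable_iInf.comp
    (measurable_pi_lambda _ fun i => measurable_orthogonal.comp (measurable_pi_apply i)))

instance instMeasurableInf₂Subspace : MeasurableInf₂ (Submodule ℝ (EuclideanSpace ℝ (Fin N))) where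
  measurable_inf := by
    simp_rw [inf_eq_iInf]
    refine measurable_iInf.comp (measurable_pi_lambda _ fun b => ?_)
    cases b
    exacts [measurable_snd, measurable_fst]

theorem measurable_finrank : Measurable
    fun W : Submodule ℝ (EuclideanSpace ℝ (Fin N)) => finrank ℝ W := by
  refine Nat.isClosedEmbedding_coe_real.measurableEmbedding.measurable_comp_iff.1 ?_
  simp_rw [Function.comp_def,
    fun W => finrank_eq_sum_inner_starProjection W (EuclideanSpace.basisFun (Fin N) ℝ)]
  exact Finset.measurable_sum _ fun i _ =>
    measurable_const.inner (measurable_starProjection_apply _)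

theorem measurable_finrank_inf (F : Submodule ℝ (EuclideanSpace ℝ (Fin N))) : Measurable
    fun W : Submodule ℝ (EuclideanSpace ℝ (Fin N)) => finrank ℝ ↥(W ⊓ F) :=
  measurable_finrank.comp (measurable_id.inf_const F)

end Measurability

section RandomSubspace

variable {Ω : Type*} [MeasurableSpace Ω] {P : Measure Ω} {N k : ℕ}

theorem IsRandomSubspace.congr {V W : Ω → Submodule ℝ (EuclideanSpace ℝ (Fin N))}
    (hV : IsRandomSubspace P k V) (h : V =ᵐ[P] W) : IsRandomSubspace P k W where
  aemeasurable := hV.aemeasurable.congr h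
  finrank_eq := by
    filter_upwards [hV.finrank_eq, h] with ω h₁ h₂ using h₂ ▸ h₁
  invariant O := by
    have hWV : IdentDistrib (fun ω => (W ω).map O.toLinearEquiv.toLinearMap)
        (fun ω => (V ω).map O.toLinearEquiv.toLinearMap) P P :=
      .of_ae_eq ((measurable_submodule_map O).comp_aemeasurable (hV.aemeasurable.congr h))
        (by filter_upwards [h] with ω hω using by rw [hω])
    exact hWV.trans ((hV.invariant O).trans (.of_ae_eq hV.aemeasurable h))

theorem IsRandomSubspace.iSup {ι : Type*} [Finite ι] {r : ℕ} {d : ι → ℕ}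
    {V : ι → Ω → Submodule ℝ (EuclideanSpace ℝ (Fin N))}
    (hV : ∀ i, IsRandomSubspace P (d i) (V i)) (hind : iIndepFun V P)
    (hr : ∀ᵐ ω ∂P, finrank ℝ ↥(⨆ i, V i ω) = r) :
    IsRandomSubspace P r fun ω => ⨆ i, V i ω where
  aemeasurable := measurable_iSup.comp_aemeasurable
    (aemeasurable_pi_lambda _ fun i => (hV i).aemeasurable)
  finrank_eq := hr
  invariant O := by
    cases nonempty_fintype ι
    simp_rw [Submodule.map_iSup]
    have hpi := IdentDistrib.pi (fun i => (hV i).invariant O)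
      (hind.comp _ fun _ => measurable_submodule_map O) hind
    exact hpi.comp measurable_iSup

theorem exists_linearIsometryEquiv_map_eq {E : Type*} [NormedAddCommGroup E]
    [InnerProductSpace ℝ E] [FiniteDimensional ℝ E] {F G : Submodule ℝ E}
    (h : finrank ℝ F = finrank ℝ G) :
    ∃ O : E ≃ₗᵢ[ℝ] E, F.map O.toLinearEquiv.toLinearMap = G := by
  let e : F ≃ₗᵢ[ℝ] G := (stdOrthonormalBasis ℝ F).equiv (stdOrthonormalBasis ℝ G) (finCongr h)
  let f : F →ₗᵢ[ℝ] E := G.subtypeₗᵢ.comp e.toLinearIsometry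
  refine ⟨f.extend.toLinearIsometryEquiv rfl, Submodule.eq_of_le_of_finrank_eq ?_ ?_⟩
  · rintro _ ⟨x, hx, rfl⟩
    change f.extend (⟨x, hx⟩ : F) ∈ G
    rw [f.extend_apply]
    exact (e ⟨x, hx⟩).2
  · rw [LinearEquiv.finrank_map_eq, h]

theorem IsRandomSubspace.ae_finrank_inf_orthogonal_le_of_finrank_eq {l : ℕ}
    {W : Ω → Submodule ℝ (EuclideanSpace ℝ (Fin N))} (hW : IsRandomSubspace P k W)
    {F G : Submodule ℝ (EuclideanSpace ℝ (Fin N))} (hFG : finrank ℝ F = finrank ℝ G)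
    (hF : ∀ᵐ ω ∂P, finrank ℝ ↥(W ω ⊓ Fᗮ) ≤ l) : ∀ᵐ ω ∂P, finrank ℝ ↥(W ω ⊓ Gᗮ) ≤ l := by
  obtain ⟨O, rfl⟩ := exists_linearIsometryEquiv_map_eq hFG
  have hmap : ∀ V : Submodule ℝ (EuclideanSpace ℝ (Fin N)),
      finrank ℝ ↥(V.map O.toLinearEquiv.toLinearMap ⊓ (F.map O.toLinearEquiv.toLinearMap)ᗮ) =
        finrank ℝ ↥(V ⊓ Fᗮ) := fun V => by
    rw [← Submodule.map_orthogonal_equiv, ← Submodule.map_inf _ O.injective,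
      LinearEquiv.finrank_map_eq]
  refine (hW.invariant O).ae_snd (measurableSet_le (measurable_finrank_inf _) measurable_const) ?_
  simpa only [hmap] using hF

theorem ae_finrank_inf_orthogonal_span_singleton_le {E : Type*} [NormedAddCommGroup E]
    [InnerProductSpace ℝ E] [FiniteDimensional ℝ E] [MeasurableSpace E] [BorelSpace E]
    (μ : Measure E) [μ.IsAddHaarMeasure] (K : Submodule ℝ E) :
    ∀ᵐ x ∂μ, finrank ℝ ↥(K ⊓ (Submodule.span ℝ {x})ᗮ) ≤ finrank ℝ K - 1 := by
  rcases eq_or_ne K ⊥ with rfl | hK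
  · simp
  have hK' : Kᗮ ≠ ⊤ := by rwa [Ne, Submodule.orthogonal_eq_top_iff]
  filter_upwards [measure_eq_zero_iff_ae_notMem.1 (μ.addHaar_submodule Kᗮ hK')] with x hx
  refine Nat.le_sub_one_of_lt (Submodule.finrank_lt_finrank_of_lt ?_)
  refine inf_le_left.lt_of_not_ge fun hle => hx ?_
  refine (K.mem_orthogonal x).2 fun u hu => ?_
  exact Submodule.mem_orthogonal_singleton_iff_inner_left.1 (hle hu).2

theorem ae_ae_finrank_inf_orthogonal_sup_span_singleton_le [SFinite P] {l : ℕ}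
    {W : Ω → Submodule ℝ (EuclideanSpace ℝ (Fin N))} (hW : AEMeasurable W P)
    {F : Submodule ℝ (EuclideanSpace ℝ (Fin N))}
    (hF : ∀ᵐ ω ∂P, finrank ℝ ↥(W ω ⊓ Fᗮ) ≤ l) :
    ∀ᵐ x ∂(volume : Measure (EuclideanSpace ℝ (Fin N))),
      ∀ᵐ ω ∂P, finrank ℝ ↥(W ω ⊓ (F ⊔ Submodule.span ℝ {x})ᗮ) ≤ l - 1 := by
  have hmeas : MeasurableSet {p : Submodule ℝ (EuclideanSpace ℝ (Fin N)) ×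
      EuclideanSpace ℝ (Fin N) |
        finrank ℝ ↥(p.1 ⊓ (Fᗮ ⊓ (Submodule.span ℝ {p.2})ᗮ)) ≤ l - 1} :=
    measurableSet_le (measurable_finrank.comp (measurable_fst.inf (measurable_const.inf
      (measurable_orthogonal.comp (measurable_span_singleton.comp measurable_snd)))))
      measurable_const
  have hlaw : ∀ᵐ V ∂P.map W, ∀ᵐ x ∂(volume : Measure (EuclideanSpace ℝ (Fin N))),
      finrank ℝ ↥(V ⊓ (Fᗮ ⊓ (Submodule.span ℝ {x})ᗮ)) ≤ l - 1 := by
    have hF' : ∀ᵐ V ∂P.map W, finrank ℝ ↥(V ⊓ Fᗮ) ≤ l :=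
      (ae_map_iff hW (measurableSet_le (measurable_finrank_inf _) measurable_const)).2 hF
    filter_upwards [hF'] with V hV
    filter_upwards [ae_finrank_inf_orthogonal_span_singleton_le volume (V ⊓ Fᗮ)] with x hx
    rw [← inf_assoc]
    exact hx.trans (Nat.sub_le_sub_right hV 1)
  filter_upwards [(Measure.ae_ae_comm hmeas).1 hlaw] with x hx
  filter_upwards [ae_of_ae_map hW hx] with ω hω
  rwa [← Submodule.inf_orthogonal]

theorem IsRandomSubspace.ae_finrank_inf_orthogonal_le [SFinite P]
    {W : Ω → Submodule ℝ (EuclideanSpace ℝ (Fin N))} (hW : IsRandomSubspace P k W)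
    (F : Submodule ℝ (EuclideanSpace ℝ (Fin N))) :
    ∀ᵐ ω ∂P, finrank ℝ ↥(W ω ⊓ Fᗮ) ≤ k - finrank ℝ F := by
  suffices h : ∀ j ≤ N, ∃ G : Submodule ℝ (EuclideanSpace ℝ (Fin N)), finrank ℝ G = j ∧
      ∀ᵐ ω ∂P, finrank ℝ ↥(W ω ⊓ Gᗮ) ≤ k - j by
    obtain ⟨G, hG, hWG⟩ := h (finrank ℝ F) (by simpa using F.finrank_le)
    exact hW.ae_finrank_inf_orthogonal_le_of_finrank_eq hG hWG
  intro j hj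
  induction j with
  | zero =>
    refine ⟨⊥, finrank_bot _ _, ?_⟩
    filter_upwards [hW.finrank_eq] with ω hω
    rw [Submodule.bot_orthogonal_eq_top, inf_top_eq, hω, Nat.sub_zero]
  | succ j ih =>
    obtain ⟨G, hG, hWG⟩ := ih (Nat.le_of_succ_le hj)
    have hGtop : G ≠ ⊤ := by
      rintro rfl
      rw [finrank_top, finrank_euclideanSpace_fin] at hG
      omega
    obtain ⟨x, hx, hxG⟩ := ((ae_ae_finrank_inf_orthogonal_sup_span_singleton_le hW.aemeasurable
      hWG).and (measure_eq_zero_iff_ae_notMem.1 (volume.addHaar_submodule G hGtop))).exists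
    exact ⟨G ⊔ Submodule.span ℝ {x}, by rw [Submodule.finrank_sup_span_singleton hxG, hG], hx⟩

theorem IsRandomSubspace.ae_disjoint_orthogonal [SFinite P]
    {W : Ω → Submodule ℝ (EuclideanSpace ℝ (Fin N))} (hW : IsRandomSubspace P k W)
    {F : Submodule ℝ (EuclideanSpace ℝ (Fin N))} (hF : k ≤ finrank ℝ F) :
    ∀ᵐ ω ∂P, Disjoint (W ω) Fᗮ := by
  filter_upwards [hW.ae_finrank_inf_orthogonal_le F] with ω hω
  rw [Nat.sub_eq_zero_of_le hF, Nat.le_zero, Submodule.finrank_eq_zero] at hω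
  exact disjoint_iff.2 hω

theorem IsRandomSubspace.ae_rowSpace_submatrix_eq [SFinite P] {κ σ : Type*}
    [Finite κ] [Finite σ] {L : Ω → Matrix (Fin N) κ ℝ}
    (hL : IsRandomSubspace P k fun ω => colSpace (L ω)) :
    ∀ᵐ ω ∂P, ∀ s : σ → Fin N, k ≤ (Set.range s).ncard →
      rowSpace ((L ω).submatrix s id) = rowSpace (L ω) := by
  have h : ∀ᵐ ω ∂P, ∀ T : Set (Fin N), k ≤ T.ncard →
      Disjoint (colSpace (L ω)) (coordSpan T)ᗮ := by
    refine ae_all_iff.2 fun T => ?_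
    by_cases hT : k ≤ T.ncard
    · filter_upwards [hL.ae_disjoint_orthogonal (hT.trans_eq (finrank_coordSpan T).symm)]
        with ω hω _ using hω
    · exact .of_forall fun _ h => absurd h hT
  filter_upwards [h] with ω hω s hs
  exact rowSpace_submatrix_eq_of_disjoint (hω _ hs)

end RandomSubspace

section CouponCollector

variable {Ω : Type*} [MeasurableSpace Ω] {P : Measure Ω}

theorem measureReal_forall_notMem_le {ι α : Type*} [Fintype ι] [MeasurableSpace α]
    {X : ι → Ω → α} (hX : ∀ j, Measurable (X j)) (hind : iIndepFun X P) {B : Set α}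
    (hB : MeasurableSet B) {p : ℝ} (hp : ∀ j, p ≤ P.real (X j ⁻¹' B)) :
    P.real {ω | ∀ j, X j ω ∉ B} ≤ Real.exp (-(Fintype.card ι * p)) := by
  have := hind.isProbabilityMeasure
  have hset : {ω | ∀ j, X j ω ∉ B} = ⋂ j ∈ Finset.univ, X j ⁻¹' Bᶜ := by
    ext ω
    simp
  have hmiss : ∀ j, P.real (X j ⁻¹' Bᶜ) ≤ Real.exp (-p) := fun j => by
    rw [Set.preimage_compl, probReal_compl_eq_one_sub (hX j hB)]
    linarith [hp j, Real.add_one_le_exp (-p)]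
  calc P.real {ω | ∀ j, X j ω ∉ B} = ∏ j, P.real (X j ⁻¹' Bᶜ) := by
        rw [hset, measureReal_def, hind.measure_inter_preimage_eq_mul _ fun _ _ => hB.compl,
          ENNReal.toReal_prod]
        rfl
    _ ≤ ∏ _j : ι, Real.exp (-p) :=
        Finset.prod_le_prod (fun _ _ => measureReal_nonneg) fun j _ => hmiss j
    _ = Real.exp (-(Fintype.card ι * p)) := by
        rw [Finset.prod_const, Finset.card_univ, ← Real.exp_nat_mul, mul_neg]

theorem measureReal_exists_forall_notMem_le {ι α β : Type*} [Fintype ι] [Fintype β]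
    [MeasurableSpace α] {X : ι → Ω → α} (hX : ∀ j, Measurable (X j)) (hind : iIndepFun X P)
    {B : β → Set α} (hB : ∀ b, MeasurableSet (B b)) {p : ℝ}
    (hp : ∀ b j, p ≤ P.real (X j ⁻¹' B b)) :
    P.real {ω | ∃ b, ∀ j, X j ω ∉ B b} ≤ Fintype.card β * Real.exp (-(Fintype.card ι * p)) := by
  simp_rw [Set.ofPred_exists]
  refine (measureReal_iUnion_fintype_le _).trans ?_
  refine (Finset.sum_le_sum fun b _ => measureReal_forall_notMem_le hX hind (hB b) (hp b)).trans ?_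
  simp

variable {N m r : ℕ} {S : Fin m → Ω → Fin N}

theorem IsUniformSample.measureReal_preimage (hS : IsUniformSample P S) (j : Fin m)
    (B : Finset (Fin N)) : P.real (S j ⁻¹' B) = B.card / N := by
  have := hS.indep.isProbabilityMeasure
  have hsing : ∀ i, P.real (S j ⁻¹' {i}) = 1 / (N : ℝ) := hS.uniform j
  rw [← sum_measureReal_preimage_singleton B fun i _ => hS.measurable j (measurableSet_singleton i)]
  simp [hsing, div_eq_mul_inv]

/-- The residue class of `b` modulo `r` in `{0, …, N - 1}`. These classes are the coupons: a sample
hitting all of them has at least `r` distinct values. -/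
def residueClass (N : ℕ) {r : ℕ} (b : Fin r) : Finset (Fin N) :=
  {i | (i : ℕ) % r = b}

theorem div_two_mul_le_card_residueClass (hrN : r ≤ N) (b : Fin r) :
    (N : ℝ) / (2 * r) ≤ (residueClass N b).card := by
  have hr := b.pos
  have hdiv : N / r ≤ (residueClass N b).card := by
    have hcount : (residueClass N b).card = N.count (· ≡ b [MOD r]) := by
      rw [Nat.count_eq_card_filter_range, ← Nat.Iio_eq_range, ← Fin.map_valEmbedding_univ,
        Finset.filter_map, Finset.card_map]
      simp [residueClass, Nat.ModEq, Nat.mod_eq_of_lt b.2]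
    rw [hcount, Nat.count_modEq_card N hr]
    exact Nat.le_add_right _ _
  have hnat : N ≤ 2 * r * (N / r) := by
    have h₁ := Nat.div_add_mod N r
    have h₂ := Nat.mod_lt N hr
    have h₃ : r * 1 ≤ r * (N / r) := Nat.mul_le_mul_left r (Nat.div_pos hrN hr)
    rw [mul_assoc]
    omega
  rw [div_le_iff₀ (by positivity)]
  calc (N : ℝ) ≤ 2 * r * (N / r : ℕ) := by exact_mod_cast hnat
    _ = (N / r : ℕ) * (2 * r) := by ring
    _ ≤ (residueClass N b).card * (2 * r) := by gcongr

theorem le_ncard_range_of_forall_exists_mem_residueClass {σ : Type*} [Finite σ] {s : σ → Fin N}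
    (h : ∀ b : Fin r, ∃ j, s j ∈ residueClass N b) : r ≤ (Set.range s).ncard := by
  choose j hj using h
  have hinj : Function.Injective fun b => s (j b) := fun b c hbc => by
    have hval : ∀ a, (s (j a) : ℕ) % r = a := by simpa [residueClass] using hj
    exact Fin.ext (by rw [← hval b, ← hval c, show s (j b) = s (j c) from hbc])
  calc r = (Set.range fun b => s (j b)).ncard := by
        rw [← Set.image_univ, Set.ncard_image_of_injective _ hinj, Set.ncard_univ, Nat.card_fin]
    _ ≤ (Set.range s).ncard := Set.ncard_le_ncard (Set.range_comp_subset_range j s)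

theorem IsUniformSample.measureReal_ncard_range_lt_le (hS : IsUniformSample P S) (hrN : r ≤ N) :
    P.real {ω | (Set.range fun j => S j ω).ncard < r} ≤ r * Real.exp (-(m / (2 * r))) := by
  have := hS.indep.isProbabilityMeasure
  have hdens (b : Fin r) (j : Fin m) : 1 / (2 * r : ℝ) ≤ P.real (S j ⁻¹' residueClass N b) := by
    have hN : (0 : ℝ) < N := by exact_mod_cast b.pos.trans_le hrN
    rw [hS.measureReal_preimage, le_div_iff₀ hN]
    simpa [div_eq_inv_mul] using div_two_mul_le_card_residueClass hrN b
  have hsub : {ω | (Set.range fun j => S j ω).ncard < r} ⊆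
      {ω | ∃ b : Fin r, ∀ j, S j ω ∉ (residueClass N b : Set (Fin N))} := fun ω hω => by
    by_contra! hhit
    exact hω.not_ge (le_ncard_range_of_forall_exists_mem_residueClass (by simpa using hhit))
  refine (measureReal_mono hsub).trans ?_
  simpa [div_eq_mul_inv] using measureReal_exists_forall_notMem_le hS.measurable hS.indep
    (fun b => (residueClass N b).measurableSet) hdens

end CouponCollector

section Model

variable {Ω : Type*} [MeasurableSpace Ω] {P : Measure Ω}

theorem FollowsSubspaceModel.isRandomSubspace_colSpace {N n r : ℕ} {d : Fin n → ℕ}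
    {L : Ω → Matrix (Fin N) ((i : Fin n) × Fin (d i)) ℝ} (hL : FollowsSubspaceModel P N n r d L)
    (hrank : ∀ᵐ ω ∂P, (L ω).rank = r) : IsRandomSubspace P r fun ω => colSpace (L ω) := by
  obtain ⟨_, hnr, U, Q, _, _, hUQ, hU, hind, _⟩ := hL
  have hcol : ∀ᵐ ω ∂P, ⨆ i, colSpace (U i ω) = colSpace (L ω) := by
    filter_upwards [hrank] with ω hω
    rw [hUQ] at hω ⊢
    rw [colSpace_blockMatrix_eq_iSup _ _ (by rw [hω, Nat.mul_div_cancel' hnr])]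
  refine (IsRandomSubspace.iSup hU hind ?_).congr hcol
  filter_upwards [hcol, hrank] with ω h₁ h₂
  rw [h₁, finrank_colSpace, h₂]

theorem IsRandomSubspace.le [NeZero P] {d k : ℕ} {W : Ω → Submodule ℝ (EuclideanSpace ℝ (Fin d))}
    (hW : IsRandomSubspace P k W) : k ≤ d := by
  obtain ⟨ω, hω⟩ := hW.finrank_eq.exists
  simpa [hω] using (W ω).finrank_le

theorem two_mul_log_le_of_threshold_le {r m x δ φ : ℝ} (hr : 0 < r) (hδ : 0 < δ) (hm : 0 ≤ m)
    (hφ : φ = max r x / r) (h : 10 * (1 / 5) * r * φ * Real.log (2 * r / δ) ≤ m) :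
    2 * r * Real.log (r / δ) ≤ m := by
  have hmax : r * φ = max r x := by rw [hφ, mul_div_cancel₀ _ hr.ne']
  have hlog : Real.log (r / δ) ≤ Real.log (2 * r / δ) := by
    gcongr
    linarith
  rcases le_total 0 (Real.log (2 * r / δ)) with hpos | hneg
  · calc 2 * r * Real.log (r / δ) ≤ 2 * r * Real.log (2 * r / δ) := by gcongr
      _ ≤ 2 * (r * φ) * Real.log (2 * r / δ) := by
          rw [hmax]
          gcongr
          exact le_max_left r x
      _ ≤ m := by linarith
  · exact (mul_nonpos_of_nonneg_of_nonpos (by positivity) (hlog.trans hneg)).trans hm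

end Model

end RowSampling

theorem lemma3_general {Ω κ : Type*} [MeasurableSpace Ω] [Finite κ] {P : Measure Ω}
    {N m r : ℕ} {δ : ℝ} {L : Ω → Matrix (Fin N) κ ℝ} {S : Fin m → Ω → Fin N} (hr : 0 < r)
    (hδ : 0 < δ) (hL : RowSampling.IsRandomSubspace P r fun ω => RowSampling.colSpace (L ω))
    (hS : RowSampling.IsUniformSample P S) (hm : 2 * r * Real.log (r / δ) ≤ m) :
    1 - δ ≤ P.real {ω | RowSampling.rowSpace ((L ω).submatrix (fun j => S j ω) id) =
      RowSampling.rowSpace (L ω)} := by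
  have := hS.indep.isProbabilityMeasure
  set few : Set Ω := {ω | (Set.range fun j => S j ω).ncard < r}
  set good : Set Ω := {ω | RowSampling.rowSpace ((L ω).submatrix (fun j => S j ω) id) =
    RowSampling.rowSpace (L ω)}
  have hcover : ∀ᵐ ω ∂P, ω ∈ few ∪ good := by
    filter_upwards [hL.ae_rowSpace_submatrix_eq (σ := Fin m)] with ω hω
    exact (lt_or_ge _ r).imp_right (hω fun j => S j ω)
  have hsum : 1 ≤ P.real few + P.real good := by
    rw [← probReal_univ (μ := P), ← measureReal_congr (Filter.eventuallyEq_univ.2 hcover)]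
    exact measureReal_union_le few good
  have hfew : P.real few ≤ δ :=
    calc P.real few ≤ r * Real.exp (-(m / (2 * r))) := hS.measureReal_ncard_range_lt_le hL.le
      _ ≤ r * Real.exp (-Real.log (r / δ)) := by
        gcongr
        rwa [le_div_iff₀' (by positivity)]
      _ = δ := by
        rw [Real.exp_neg, Real.exp_log (by positivity)]
        field_simp
  linarith

theorem lemma3 :
    ∃ c : ℝ, 0 < c ∧
      ∀ {Ω : Type*} [MeasurableSpace Ω] (P : Measure Ω) [IsProbabilityMeasure P]
        (N₁ n r m₂ : ℕ) (d : Fin n → ℕ) (δ φ : ℝ)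
        (L : Ω → Matrix (Fin N₁) ((i : Fin n) × Fin (d i)) ℝ)
        (S : Fin m₂ → Ω → Fin N₁),
        0 < r →
        0 < δ →
        RowSampling.FollowsSubspaceModel P N₁ n r d L →
        (∀ᵐ ω ∂P, (L ω).rank = r) →
        RowSampling.IsUniformSample P S →
        IndepFun (fun ω j => S j ω) L P →
        φ = max (r : ℝ) (Real.log N₁) / r →
        10 * c * r * φ * Real.log (2 * r / δ) ≤ m₂ →
        1 - δ - 2 * (N₁ : ℝ) ^ (-3 : ℤ) ≤
          P.real {ω | RowSampling.rowSpace ((L ω).submatrix (fun j => S j ω) id) =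
            RowSampling.rowSpace (L ω)} := by
  refine ⟨1 / 5, by norm_num, fun P _ N₁ n r m₂ d δ φ L S hr hδ hL hrank hS _ hφ hm => ?_⟩
  have hmain := lemma3_general hr hδ (hL.isRandomSubspace_colSpace hrank) hS
    (RowSampling.two_mul_log_le_of_threshold_le (Nat.cast_pos.2 hr) hδ m₂.cast_nonneg hφ hm)
  have hN : 0 ≤ 2 * (N₁ : ℝ) ^ (-3 : ℤ) := by positivity
  linarith
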